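/- Let $n\ge 2$ be an integer and $w>1$ a real number. Let $A(w)$ be the adjacency matrix of the path on the vertices $1,\dots,n$ with a loop of weight $w$ added at each of the two end vertices, let $\lambda_1\ge\lambda_2\ge\dots\ge\lambda_n$ be its eigenvalues, and let $V=[v_{ij}]$ be any real orthogonal matrix with $V^TA(w)V=\mathrm{diag}(\lambda_1,\dots,\lambda_n)$. For real $t$ let $p(t)=\left|\left(e^{itA(w)}\right)_{1,n}\right|^2$ be the fidelity of state transfer between the end vertices. Put $$\tau_n=\frac{(w+1)^2(w-1)}{w\left(w^{2\lceil n/2\rceil}-1\right)},\qquad s=\sqrt{\left(w+\tfrac1w-\tau_n\right)^2-4},$$ $$\sigma_n=\frac{\tau_n}{\left(2w+\frac{16}{(n-1)(w-\frac1w)}\right)\left(w+\frac1w-\tau_n+s+\frac{16}{(n-1)s}\right)}\left[w-\frac1w+\frac{(w+\frac1w)\left(-2(w+\frac1w)+\tau_n\right)}{w-\frac1w+s}+\frac{16\left(-2(w+\frac1w)+\tau_n\right)}{(n-1)(w-\frac1w)s}\right],$$ where, if $w+\frac1w-\tau_n=2$ (so that $s=0$), $\sigma_n$ is read as the limit of this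 expression as $s\to0^+$, namely $$\sigma_n=\frac{\tau_n\left(-2(w+\frac1w)+\tau_n\right)}{\left(2w+\frac{16}{(n-1)(w-\frac1w)}\right)\left(w-\frac1w\right)}.$$ Suppose that $w+\frac1w-\tau_n\ge 2$. Let $t\in\mathbb R$, set $\alpha=t(\lambda_1-\lambda_2)$, and suppose that $\alpha$ is not an even multiple of $\pi$. Then $$\left|v_{11}^2-v_{12}^2e^{it(\lambda_2-\lambda_1)}\right|+v_{11}^2+v_{12}^2-1\ \ge\ L,$$ where $$L=\frac{w^2-1}{w^2}\sqrt{\frac{1-\cos\alpha}{2}}-\frac1{w^2}+\frac{(w^2-1)(1-\cos^2\alpha)}{\sqrt{8(1-\cos\alpha)}}\left(-\frac{8}{(n-1)w^2}\left[\frac{1}{1+\frac{8}{(n-1)(w^2-1)}}\right]+\sigma_n\right).$$ In particular, if $L\ge 0$, then $p(t)\ge L^2$. -/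

import Mathlib

open scoped Matrix

noncomputable section

namespace PathFidelity

/-- Adjacency matrix `A(w)` of the path on `n` vertices (labelled `0, …, n - 1`) with a loop of
weight `w` added at each of the two end vertices. -/
def A (n : ℕ) (w : ℝ) : Matrix (Fin n) (Fin n) ℝ :=
  Matrix.of fun i j =>
    if (i : ℕ) + 1 = j ∨ (j : ℕ) + 1 = i then 1
    else if i = j ∧ ((i : ℕ) = 0 ∨ (i : ℕ) + 1 = n) then w
    else 0

/-- The transition matrix `U(t) = exp (i t A(w))`. -/
def U (n : ℕ) (w t : ℝ) : Matrix (Fin n) (Fin n) ℂ :=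
  NormedSpace.exp ((Complex.I * (t : ℂ)) • (A n w).map (fun x : ℝ => (x : ℂ)))

/-- The fidelity `|U(t)_{a,b}|²` of state transfer from vertex `a` to vertex `b` at time `t`. -/
def fidelity (n : ℕ) (w : ℝ) (a b : Fin n) (t : ℝ) : ℝ :=
  ‖U n w t a b‖ ^ 2

/-- `τ_n = (w + 1)² (w - 1) / (w (w ^ (2⌈n/2⌉) - 1))`. -/
def tau (n : ℕ) (w : ℝ) : ℝ :=
  (w + 1) ^ 2 * (w - 1) / (w * (w ^ (2 * ⌈(n : ℝ) / 2⌉₊) - 1))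

/-- The correction term `σ_n`. With `s = √((w + 1/w - τ_n)² - 4)`, the general expression has `s` in
a denominator both in its prefactor and in its bracket. In the boundary case `w + 1/w - τ_n = 2`,
where `s = 0`, the value is the limit of that expression as `s → 0⁺` (multiply the prefactor's
second denominator and the bracket by `s`). -/
def sigma (n : ℕ) (w : ℝ) : ℝ :=
  let s : ℝ := √((w + 1 / w - tau n w) ^ 2 - 4)
  if w + 1 / w - tau n w = 2 then
    tau n w * (-2 * (w + 1 / w) + tau n w) /
      ((2 * w + 16 / (((n : ℝ) - 1) * (w - 1 / w))) * (w - 1 / w))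
  else
    tau n w /
        ((2 * w + 16 / (((n : ℝ) - 1) * (w - 1 / w))) *
          (w + 1 / w - tau n w + s + 16 / (((n : ℝ) - 1) * s))) *
      (w - 1 / w
        + (w + 1 / w) * (-2 * (w + 1 / w) + tau n w) / (w - 1 / w + s)
        + 16 * (-2 * (w + 1 / w) + tau n w) / (((n : ℝ) - 1) * (w - 1 / w) * s))

/-- The explicit lower bound, as a function of `n`, `w` and the angle `α`. -/
def lowerBound (n : ℕ) (w α : ℝ) : ℝ :=
  (w ^ 2 - 1) / w ^ 2 * √((1 - Real.cos α) / 2) - 1 / w ^ 2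
    + (w ^ 2 - 1) * (1 - Real.cos α ^ 2) / √(8 * (1 - Real.cos α)) *
      (-(8 / (((n : ℝ) - 1) * w ^ 2)) * (1 / (1 + 8 / (((n : ℝ) - 1) * (w ^ 2 - 1)))) + sigma n w)

end PathFidelity

end

/-!
The matrix `A n w` commutes with the reflection of the path, so its eigenvectors can be taken
symmetric or antisymmetric; the top one is symmetric and the second antisymmetric. Writing
`a = v₁₁²` and `b = v₁₂²`, these two contribute `a e^{itλ₁} - b e^{itλ₂}` to the corner entry of
`exp (itA)`, and all the others together at most `1 - a - b` in modulus (`sub_le_norm_U`), whence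
the lower bound on the fidelity.

The correction term in `lowerBound` is nonpositive, since `sigma` is (`sigma_nonpos`), and for given
`a + b` the modulus `|a - b e^{iθ}|` is smallest at `a = b` (`add_mul_sqrt_le_norm`). It therefore
suffices that `a + b ≥ 1 - 1/w²`, and this is what `goodColumns` proves.

For `n = 2` and `n = 3` the eigenvectors are written down. For `n ≥ 4` they are
`x ^ (n - 1 - j) ± x ^ j` (`profile`), with eigenvalue `x + 1/x` where `± x ^ n (x - w) = w x - 1`.
The symmetric root `x` exceeds `w`, and the antisymmetric root `y` lies strictly between `1` and
`w`; at most two eigenvalues exceed `2` (`lam_le_two`), so these two are `λ₁` and `λ₂`. Put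
`p = w (x + 1/x - (w + 1/w)) / (w² - 1)`, `q = w (w + 1/w - (y + 1/y)) / (w² - 1)` and
`κ = 2 (w² + 1) / (w² - 1)`. A geometric sum and the equation for the root give
`2w²/(w² - 1) a = (1 + κp + p²)/(1 + np)` and `2w²/(w² - 1) b = (1 - κq + q²)/(1 - nq)`
(`profile_zero_sq_div`). The hypothesis on `tau` forces `κ ≤ n` (`le_mul_sq_of_two_le_sub_tau`), and
`p ≤ q` by Bernoulli's inequality (`gap_le_gap`), so the two right-hand sides add up to at least `2`
(`weights_add_ge`).
-/

namespace PathFidelity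

/-! ### The action of the adjacency matrix -/

lemma A_transpose (n : ℕ) (w : ℝ) : (A n w)ᵀ = A n w := by
  ext i j
  simp only [A, Matrix.transpose_apply, Matrix.of_apply]
  have h1 : ((j : ℕ) + 1 = i ∨ (i : ℕ) + 1 = j) ↔ ((i : ℕ) + 1 = j ∨ (j : ℕ) + 1 = i) := or_comm
  by_cases hij : i = j
  · subst hij; rfl
  · simp only [h1, hij, Ne.symm hij, false_and]

/-- The action of `A n w` on a sequence: the sum over the two neighbours, where a missing
neighbour is replaced by `w` times the value at the vertex itself. -/
lemma A_mulVec {n : ℕ} (hn : 2 ≤ n) (w : ℝ) (f : ℕ → ℝ) (i : Fin n) :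
    (A n w *ᵥ fun j : Fin n => f j) i =
      (if (i : ℕ) + 1 < n then f (i + 1) else w * f i) +
        (if 0 < (i : ℕ) then f (i - 1) else w * f i) := by
  have hi := i.2
  have key : ∀ j : Fin n, A n w i j * f j =
      (if (i : ℕ) + 1 = j then f (i + 1) else 0) + (if (i : ℕ) - 1 = j then
        (if 0 < (i : ℕ) then f (i - 1) else 0) else 0) +
        (if (i : ℕ) = j then (if (i : ℕ) = 0 ∨ (i : ℕ) + 1 = n then w * f i else 0) else 0) := by
    intro j
    simp only [A, Matrix.of_apply, Fin.ext_iff]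
    have hj := j.2
    rcases lt_trichotomy (i : ℕ) j with h | h | h
    · by_cases h' : (i : ℕ) + 1 = j
      · rw [if_pos (Or.inl h'), if_pos h', if_neg (by omega), if_neg (by omega), ← h']; ring
      · rw [if_neg (by omega), if_neg (by omega), if_neg h', if_neg (by omega), if_neg (by omega)]
        ring
    · rw [if_neg (by omega), if_neg (by omega : ¬ (i : ℕ) + 1 = j), if_pos h, ← h]
      by_cases h0 : (i : ℕ) = 0 <;> by_cases h1 : (i : ℕ) + 1 = n <;>
        simp [h0, h1]
      all_goals (intros; omega)
    · by_cases h' : (j : ℕ) + 1 = i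
      · rw [if_pos (Or.inr h'), if_neg (by omega), if_pos (by omega), if_pos (by omega),
          if_neg (by omega), show (i : ℕ) - 1 = j by omega]; ring
      · rw [if_neg (by omega), if_neg (by omega), if_neg (by omega), if_neg (by omega),
          if_neg (by omega)]
        ring
  simp only [Matrix.mulVec, dotProduct, key]
  rw [Fin.sum_univ_eq_sum_range (fun j =>
    (if (i : ℕ) + 1 = j then f (i + 1) else 0) + (if (i : ℕ) - 1 = j then
        (if 0 < (i : ℕ) then f (i - 1) else 0) else 0) +
        (if (i : ℕ) = j then (if (i : ℕ) = 0 ∨ (i : ℕ) + 1 = n then w * f i else 0) else 0)) n]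
  simp only [Finset.sum_add_distrib, Finset.sum_ite_eq, Finset.mem_range]
  rw [if_pos hi, if_pos (by omega : (i : ℕ) - 1 < n)]
  by_cases h0 : (i : ℕ) = 0
  · have h1 : (i : ℕ) + 1 < n := by omega
    simp [h0, show 1 < n by omega]
  · by_cases h1 : (i : ℕ) + 1 = n
    · simp [h1, Nat.pos_of_ne_zero h0]; ring
    · have h2 : (i : ℕ) + 1 < n := by omega
      simp [h0, h1, h2, Nat.pos_of_ne_zero h0]

lemma A_nonneg (n : ℕ) {w : ℝ} (hw : 0 ≤ w) (i j : Fin n) : 0 ≤ A n w i j := by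
  simp only [A, Matrix.of_apply]
  split_ifs <;> positivity

/-- Away from the two loops every row of `A n w` sums to `2`, so the quadratic form is at most
`2‖u‖²` on vectors vanishing at both ends. -/
lemma dotProduct_A_mulVec_le {n : ℕ} (hn : 2 ≤ n) {w : ℝ} (hw : 0 ≤ w) (u : Fin n → ℝ)
    (hu : ∀ i : Fin n, ((i : ℕ) = 0 ∨ (i : ℕ) + 1 = n) → u i = 0) :
    u ⬝ᵥ (A n w *ᵥ u) ≤ 2 * (u ⬝ᵥ u) := by
  have hrow : ∀ i : Fin n, u i ^ 2 * ∑ j, A n w i j = 2 * u i ^ 2 := by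
    intro i
    by_cases h : (i : ℕ) = 0 ∨ (i : ℕ) + 1 = n
    · simp [hu i h]
    · have := A_mulVec hn w (fun _ => 1) i
      simp only [Matrix.mulVec, dotProduct, mul_one] at this
      have hi := i.2
      rw [this, if_pos (by omega), if_pos (by omega)]; ring
  have hsym : ∀ i j, A n w j i = A n w i j := fun i j => congrFun (congrFun (A_transpose n w) i) j
  have h1 : ∀ i j, u i * (A n w i j * u j) ≤ (u i ^ 2 * A n w i j + u j ^ 2 * A n w j i) / 2 := by
    intro i j
    rw [hsym i j]
    nlinarith [mul_nonneg (A_nonneg n hw i j) (sq_nonneg (u i - u j))]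
  calc u ⬝ᵥ (A n w *ᵥ u) = ∑ i, ∑ j, u i * (A n w i j * u j) := by
        simp only [dotProduct, Matrix.mulVec, Finset.mul_sum]
    _ ≤ ∑ i, ∑ j, (u i ^ 2 * A n w i j + u j ^ 2 * A n w j i) / 2 :=
        Finset.sum_le_sum fun i _ => Finset.sum_le_sum fun j _ => h1 i j
    _ = ∑ i, u i ^ 2 * ∑ j, A n w i j := by
        simp only [← Finset.sum_div, Finset.sum_add_distrib]
        rw [Finset.sum_comm (f := fun i j => u j ^ 2 * A n w j i)]
        simp only [Finset.mul_sum]; ring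
    _ = 2 * (u ⬝ᵥ u) := by
        simp only [hrow, dotProduct, Finset.mul_sum]
        exact Finset.sum_congr rfl fun i _ => by ring

/-! ### Diagonalization -/

section Diagonalization

variable {ι : Type*} [Fintype ι] [DecidableEq ι] {M V : Matrix ι ι ℝ} {lam : ι → ℝ}

lemma mul_eq_of_diag (hV : V ∈ Matrix.orthogonalGroup ι ℝ)
    (hd : Vᵀ * M * V = Matrix.diagonal lam) : M = V * Matrix.diagonal lam * Vᵀ := by
  have h1 : V * Vᵀ = 1 := (Matrix.mem_orthogonalGroup_iff ι ℝ).1 hV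
  rw [← hd]
  calc M = (V * Vᵀ) * M * (V * Vᵀ) := by rw [h1]; simp
    _ = _ := by simp only [Matrix.mul_assoc]

lemma transpose_mulVec_eigen (hV : V ∈ Matrix.orthogonalGroup ι ℝ)
    (hd : Vᵀ * M * V = Matrix.diagonal lam) {u : ι → ℝ} {μ : ℝ} (hu : M *ᵥ u = μ • u) (j : ι) :
    (lam j - μ) * (Vᵀ *ᵥ u) j = 0 := by
  have h2 : Vᵀ * V = 1 := (Matrix.mem_orthogonalGroup_iff' ι ℝ).1 hV
  have h : Matrix.diagonal lam *ᵥ (Vᵀ *ᵥ u) = μ • (Vᵀ *ᵥ u) := by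
    have h3 : Vᵀ * M = Matrix.diagonal lam * Vᵀ := by
      rw [mul_eq_of_diag hV hd, ← Matrix.mul_assoc, ← Matrix.mul_assoc, h2, Matrix.one_mul]
    rw [Matrix.mulVec_mulVec, ← h3, ← Matrix.mulVec_mulVec, hu, Matrix.mulVec_smul]
  have := congrFun h j
  rw [Matrix.mulVec_diagonal, Pi.smul_apply, smul_eq_mul] at this
  linarith

lemma mulVec_transpose_mulVec (hV : V ∈ Matrix.orthogonalGroup ι ℝ) (u : ι → ℝ) :
    V *ᵥ (Vᵀ *ᵥ u) = u := by
  have h1 : V * Vᵀ = 1 := (Matrix.mem_orthogonalGroup_iff ι ℝ).1 hV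
  rw [Matrix.mulVec_mulVec, h1, Matrix.one_mulVec]

lemma dotProduct_mulVec_orthogonal (hV : V ∈ Matrix.orthogonalGroup ι ℝ) (c d : ι → ℝ) :
    (V *ᵥ c) ⬝ᵥ (V *ᵥ d) = c ⬝ᵥ d := by
  have h2 : Vᵀ * V = 1 := (Matrix.mem_orthogonalGroup_iff' ι ℝ).1 hV
  rw [Matrix.dotProduct_mulVec, ← Matrix.mulVec_transpose, Matrix.mulVec_mulVec, h2,
    Matrix.one_mulVec]

lemma exists_lam_eq (hV : V ∈ Matrix.orthogonalGroup ι ℝ)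
    (hd : Vᵀ * M * V = Matrix.diagonal lam) {u : ι → ℝ} {μ : ℝ} (hu : M *ᵥ u = μ • u)
    (hu0 : u ≠ 0) : ∃ j, lam j = μ := by
  by_contra! h
  apply hu0
  rw [← mulVec_transpose_mulVec hV u]
  have : Vᵀ *ᵥ u = 0 := by
    ext j
    exact (mul_eq_zero.1 (transpose_mulVec_eigen hV hd hu j)).resolve_left (sub_ne_zero.2 (h j))
  rw [this, Matrix.mulVec_zero]

/-- For a simple eigenvalue, the rank-one projection onto the eigenline is the same whether it is
computed from the orthonormal column or from an arbitrary eigenvector. -/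
lemma column_mul_column (hV : V ∈ Matrix.orthogonalGroup ι ℝ)
    (hd : Vᵀ * M * V = Matrix.diagonal lam) {u : ι → ℝ} {μ : ℝ} (hu : M *ᵥ u = μ • u)
    {i : ι} (hi : ∀ j, j ≠ i → lam j ≠ μ) (p q : ι) :
    V p i * V q i * (u ⬝ᵥ u) = u p * u q := by
  set d := Vᵀ *ᵥ u with hdd
  have hd0 : d = Pi.single i (d i) := by
    ext j
    by_cases h : j = i
    · subst h; simp
    · rw [Pi.single_eq_of_ne h]
      exact (mul_eq_zero.1 (transpose_mulVec_eigen hV hd hu j)).resolve_left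
        (sub_ne_zero.2 (hi j h))
  have huV : u = V *ᵥ d := (mulVec_transpose_mulVec hV u).symm
  have hcol : ∀ p, u p = V p i * d i := by
    intro p
    rw [huV, hd0, Matrix.mulVec_single]; simp
  have huu : u ⬝ᵥ u = d i * d i := by
    rw [huV, dotProduct_mulVec_orthogonal hV, hd0]; simp
  rw [huu, hcol p, hcol q]; ring

lemma sum_row_sq (hV : V ∈ Matrix.orthogonalGroup ι ℝ) (p : ι) : ∑ k, V p k ^ 2 = 1 := by
  have h1 : V * Vᵀ = 1 := (Matrix.mem_orthogonalGroup_iff ι ℝ).1 hV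
  have := congrFun (congrFun h1 p) p
  simpa [Matrix.mul_apply, sq] using this

end Diagonalization

/-! ### Locating the two largest eigenvalues -/

/-- Only two eigenvalues can exceed `2`: three eigenvectors span a nonzero vector that vanishes at
both ends, where the quadratic form is at most `2‖u‖²`. -/
lemma lam_le_two {n : ℕ} (hn : 2 ≤ n) {w : ℝ} (hw : 0 ≤ w)
    {V : Matrix (Fin n) (Fin n) ℝ} {lam : Fin n → ℝ}
    (hV : V ∈ Matrix.orthogonalGroup (Fin n) ℝ)
    (hd : Vᵀ * A n w * V = Matrix.diagonal lam) (hlam : Antitone lam)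
    {k : Fin n} (hk : 2 ≤ (k : ℕ)) : lam k ≤ 2 := by
  have hkn := k.2
  let i₁ : Fin n := ⟨0, by omega⟩
  let i₂ : Fin n := ⟨1, by omega⟩
  let l : Fin n := ⟨n - 1, by omega⟩
  have h12 : i₁ ≠ i₂ := by simp [i₁, i₂]
  have h1k : i₁ ≠ k := by simp only [i₁, ne_eq, Fin.ext_iff]; omega
  have h2k : i₂ ≠ k := by simp only [i₂, ne_eq, Fin.ext_iff]; omega
  -- A combination of three columns vanishing at both ends; the zero row makes the matrix singular.
  obtain ⟨c, hc0, hc⟩ : ∃ c : Fin 3 → ℝ, c ≠ 0 ∧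
      !![V i₁ i₁, V i₁ i₂, V i₁ k; V l i₁, V l i₂, V l k; 0, 0, 0] *ᵥ c = 0 :=
    Matrix.exists_mulVec_eq_zero_iff.2 (by simp [Matrix.det_fin_three])
  have hc1 := congrFun hc 0
  have hc2 := congrFun hc 1
  simp [Matrix.mulVec, dotProduct, Fin.sum_univ_three] at hc1 hc2
  set d : Fin n → ℝ := Pi.single i₁ (c 0) + Pi.single i₂ (c 1) + Pi.single k (c 2) with hdd
  have hd1 : d i₁ = c 0 := by simp [hdd, h12, h1k]
  have hd2 : d i₂ = c 1 := by simp [hdd, h12.symm, h2k]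
  have hd3 : d k = c 2 := by simp [hdd, h1k.symm, h2k.symm]
  have hdz : ∀ j, d j ≠ 0 → lam k ≤ lam j := by
    intro j hj
    apply hlam
    rw [Fin.le_def]
    by_contra! h
    apply hj
    have e1 : j ≠ i₁ := by rintro rfl; simp [i₁] at h
    have e2 : j ≠ i₂ := by rintro rfl; simp [i₂] at h; omega
    have e3 : j ≠ k := by rintro rfl; exact lt_irrefl _ h
    simp [hdd, e1, e2, e3]
  have hVd : ∀ p, (V *ᵥ d) p = V p i₁ * c 0 + V p i₂ * c 1 + V p k * c 2 := by
    intro p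
    simp [hdd, Matrix.mulVec_add, Matrix.mulVec_single]
    ring
  have h2 : Vᵀ * V = 1 := (Matrix.mem_orthogonalGroup_iff' (Fin n) ℝ).1 hV
  have hquad : (V *ᵥ d) ⬝ᵥ (A n w *ᵥ (V *ᵥ d)) = ∑ j, lam j * d j ^ 2 := by
    rw [mul_eq_of_diag hV hd, Matrix.mulVec_mulVec, Matrix.mul_assoc, h2, Matrix.mul_one,
      ← Matrix.mulVec_mulVec, dotProduct_mulVec_orthogonal hV]
    simp only [dotProduct, Matrix.mulVec_diagonal]
    exact Finset.sum_congr rfl fun j _ => by ring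
  have hle := dotProduct_A_mulVec_le hn hw (V *ᵥ d) (by
    rintro i (hi | hi)
    · rw [hVd, show i = i₁ from Fin.ext hi]; exact hc1
    · rw [hVd, show i = l from Fin.ext (by simp only [l]; omega)]; exact hc2)
  rw [hquad, dotProduct_mulVec_orthogonal hV] at hle
  have hlow : lam k * (d ⬝ᵥ d) ≤ ∑ j, lam j * d j ^ 2 := by
    rw [dotProduct, Finset.mul_sum]
    refine Finset.sum_le_sum fun j _ => ?_
    by_cases hj : d j = 0
    · simp [hj]
    · rw [← sq]; exact mul_le_mul_of_nonneg_right (hdz j hj) (sq_nonneg _)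
  have hdne : d ≠ 0 := by
    intro h
    apply hc0
    ext m
    fin_cases m
    · simp [← hd1, h]
    · simp [← hd2, h]
    · simp [← hd3, h]
  have hpos : 0 < d ⬝ᵥ d :=
    lt_of_le_of_ne (Finset.sum_nonneg fun j _ => mul_self_nonneg _)
      (Ne.symm (mt dotProduct_self_eq_zero.1 hdne))
  exact le_of_mul_le_mul_right (hlow.trans hle) hpos

lemma lam_eq_of_eigenvalues {n : ℕ} {M V : Matrix (Fin n) (Fin n) ℝ} {lam : Fin n → ℝ}
    (hV : V ∈ Matrix.orthogonalGroup (Fin n) ℝ)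
    (hd : Vᵀ * M * V = Matrix.diagonal lam) (hlam : Antitone lam)
    {i₁ i₂ : Fin n} (hi₁ : (i₁ : ℕ) = 0) (hi₂ : (i₂ : ℕ) = 1)
    {u₁ u₂ : Fin n → ℝ} {μ₁ μ₂ : ℝ} (hu₁ : M *ᵥ u₁ = μ₁ • u₁) (hu₂ : M *ᵥ u₂ = μ₂ • u₂)
    (hu₁0 : u₁ ≠ 0) (hu₂0 : u₂ ≠ 0) (hμ : μ₂ < μ₁)
    (hrest : ∀ k : Fin n, 2 ≤ (k : ℕ) → lam k < μ₂) : lam i₁ = μ₁ ∧ lam i₂ = μ₂ := by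
  obtain ⟨k₁, hk₁⟩ := exists_lam_eq hV hd hu₁ hu₁0
  obtain ⟨k₂, hk₂⟩ := exists_lam_eq hV hd hu₂ hu₂0
  have h1 : (k₁ : ℕ) < 2 := by
    by_contra! h; have := hrest k₁ h; linarith
  have h2 : (k₂ : ℕ) < 2 := by
    by_contra! h; have := hrest k₂ h; linarith
  have h12 : k₁ < k₂ := by
    by_contra! h; have := hlam h; linarith
  rw [Fin.lt_def] at h12
  rw [show i₁ = k₁ from Fin.ext (by omega), show i₂ = k₂ from Fin.ext (by omega)]
  exact ⟨hk₁, hk₂⟩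

/-- The first two columns of `V` are determined, up to sign, by any eigenvectors belonging to two
distinct eigenvalues that exceed all the others. -/
lemma columns_of_eigenvectors {n : ℕ} {M V : Matrix (Fin n) (Fin n) ℝ} {lam : Fin n → ℝ}
    (hV : V ∈ Matrix.orthogonalGroup (Fin n) ℝ)
    (hd : Vᵀ * M * V = Matrix.diagonal lam) (hlam : Antitone lam)
    {i₁ i₂ : Fin n} (hi₁ : (i₁ : ℕ) = 0) (hi₂ : (i₂ : ℕ) = 1)
    {u₁ u₂ : Fin n → ℝ} {μ₁ μ₂ : ℝ} (hu₁ : M *ᵥ u₁ = μ₁ • u₁) (hu₂ : M *ᵥ u₂ = μ₂ • u₂)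
    (hu₁0 : u₁ ≠ 0) (hu₂0 : u₂ ≠ 0) (hμ : μ₂ < μ₁)
    (hrest : ∀ k : Fin n, 2 ≤ (k : ℕ) → lam k < μ₂) (p q : Fin n) :
    V p i₁ * V q i₁ = u₁ p * u₁ q / (u₁ ⬝ᵥ u₁) ∧ V p i₂ * V q i₂ = u₂ p * u₂ q / (u₂ ⬝ᵥ u₂) := by
  obtain ⟨h1, h2⟩ := lam_eq_of_eigenvalues hV hd hlam hi₁ hi₂ hu₁ hu₂ hu₁0 hu₂0 hμ hrest
  rw [eq_div_iff (mt dotProduct_self_eq_zero.1 hu₁0),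
    eq_div_iff (mt dotProduct_self_eq_zero.1 hu₂0)]
  refine ⟨column_mul_column hV hd hu₁ (fun j hj => ?_) p q,
    column_mul_column hV hd hu₂ (fun j hj => ?_) p q⟩
  · have : i₂ ≤ j := by
      rw [Fin.le_def]; by_contra! h; exact hj (Fin.ext (by omega))
    have := hlam this
    exact ne_of_lt (by linarith)
  · by_cases h : (j : ℕ) = 0
    · rw [show j = i₁ from Fin.ext (by omega), h1]; exact hμ.ne'
    · have : (j : ℕ) ≠ 1 := fun h' => hj (Fin.ext (by omega))
      exact (hrest j (by omega)).ne

/-! ### From the first two columns to the fidelity -/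

lemma U_apply {n : ℕ} {w : ℝ} {V : Matrix (Fin n) (Fin n) ℝ} {lam : Fin n → ℝ}
    (hV : V ∈ Matrix.orthogonalGroup (Fin n) ℝ)
    (hd : Vᵀ * A n w * V = Matrix.diagonal lam) (t : ℝ) (a b : Fin n) :
    U n w t a b = ∑ k, ((V a k * V b k : ℝ) : ℂ) * Complex.exp (Complex.I * t * lam k) := by
  have h1 : V * Vᵀ = 1 := (Matrix.mem_orthogonalGroup_iff (Fin n) ℝ).1 hV
  set W : Matrix (Fin n) (Fin n) ℂ := V.map Complex.ofRealHom with hW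
  have hWW : W * Wᵀ = 1 := by
    rw [hW, ← Matrix.transpose_map, ← Matrix.map_mul, h1, Matrix.map_one _ (map_zero _) (map_one _)]
  have hinv : W⁻¹ = Wᵀ := Matrix.inv_eq_right_inv hWW
  have hunit : IsUnit W := IsUnit.of_mul_eq_one _ hWW
  have hA : (Complex.I * (t : ℂ)) • (A n w).map (fun x : ℝ => (x : ℂ)) =
      W * Matrix.diagonal (fun k => Complex.I * t * lam k) * W⁻¹ := by
    have e1 : (A n w).map (fun x : ℝ => (x : ℂ)) =
        W * Matrix.diagonal (fun k => (lam k : ℂ)) * Wᵀ := by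
      change (A n w).map Complex.ofRealHom = _
      rw [mul_eq_of_diag hV hd, Matrix.map_mul, Matrix.map_mul, hW, ← Matrix.transpose_map,
        Matrix.diagonal_map (map_zero _)]
      rfl
    have e2 : Matrix.diagonal (fun k => Complex.I * t * lam k) =
        (Complex.I * (t : ℂ)) • Matrix.diagonal (fun k => (lam k : ℂ)) := by
      rw [← Matrix.diagonal_smul]; rfl
    rw [e1, e2, hinv, Matrix.mul_smul, Matrix.smul_mul]
  rw [U, hA, Matrix.exp_conj _ _ hunit, Matrix.exp_diagonal, hinv, Matrix.mul_apply]
  refine Finset.sum_congr rfl fun k _ => ?_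
  rw [Matrix.mul_diagonal, Matrix.transpose_apply, Pi.coe_exp, ← Complex.exp_eq_exp_ℂ]
  simp [hW]; ring

/-- All eigenvectors other than the first two together contribute at most `1 - v₁₁² - v₁₂²` to the
amplitude. -/
lemma sub_le_norm_U {n : ℕ} {w : ℝ} {V : Matrix (Fin n) (Fin n) ℝ} {lam : Fin n → ℝ}
    (hV : V ∈ Matrix.orthogonalGroup (Fin n) ℝ)
    (hd : Vᵀ * A n w * V = Matrix.diagonal lam) (t : ℝ) {a b i₁ i₂ : Fin n} (h12 : i₁ ≠ i₂)
    (h1 : V a i₁ * V b i₁ = V a i₁ ^ 2) (h1' : V b i₁ ^ 2 = V a i₁ ^ 2)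
    (h2 : V a i₂ * V b i₂ = -V a i₂ ^ 2) (h2' : V b i₂ ^ 2 = V a i₂ ^ 2) :
    ‖((V a i₁ ^ 2 : ℝ) : ℂ) - ((V a i₂ ^ 2 : ℝ) : ℂ) *
        Complex.exp (Complex.I * (t : ℂ) * ((lam i₂ - lam i₁ : ℝ) : ℂ))‖
      + V a i₁ ^ 2 + V a i₂ ^ 2 - 1 ≤ ‖U n w t a b‖ := by
  have hnorm : ∀ x : ℝ, ‖Complex.exp (Complex.I * t * x)‖ = 1 := by
    intro x
    rw [mul_assoc, ← Complex.ofReal_mul, mul_comm, Complex.norm_exp_ofReal_mul_I]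
  set R : Finset (Fin n) := (Finset.univ.erase i₁).erase i₂ with hR
  have split : ∀ {E : Type} [AddCommMonoid E] (f : Fin n → E),
      ∑ k, f k = f i₁ + (f i₂ + ∑ k ∈ R, f k) := by
    intro E _ f
    rw [hR, Finset.add_sum_erase _ _ (Finset.mem_erase.2 ⟨h12.symm, Finset.mem_univ _⟩),
      Finset.add_sum_erase _ _ (Finset.mem_univ _)]
  have hU := U_apply hV hd t a b
  rw [split, h1, h2] at hU
  set r := ∑ k ∈ R, ((V a k * V b k : ℝ) : ℂ) * Complex.exp (Complex.I * t * lam k) with hr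
  have hrle : ‖r‖ ≤ 1 - V a i₁ ^ 2 - V a i₂ ^ 2 := by
    have ha := sum_row_sq hV a
    have hb := sum_row_sq hV b
    rw [split] at ha hb
    calc ‖r‖ ≤ ∑ k ∈ R, (V a k ^ 2 + V b k ^ 2) / 2 := by
          refine norm_sum_le_of_le _ fun k _ => ?_
          rw [norm_mul, hnorm, mul_one, Complex.norm_real, Real.norm_eq_abs, abs_mul]
          nlinarith [sq_nonneg (|V a k| - |V b k|), sq_abs (V a k), sq_abs (V b k)]
      _ = (∑ k ∈ R, V a k ^ 2 + ∑ k ∈ R, V b k ^ 2) / 2 := by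
          rw [← Finset.sum_div, Finset.sum_add_distrib]
      _ ≤ _ := by linarith
  have hmain : ‖((V a i₁ ^ 2 : ℝ) : ℂ) - ((V a i₂ ^ 2 : ℝ) : ℂ) *
        Complex.exp (Complex.I * (t : ℂ) * ((lam i₂ - lam i₁ : ℝ) : ℂ))‖ = ‖U n w t a b - r‖ := by
    have hexp : Complex.exp (Complex.I * t * lam i₂) =
        Complex.exp (Complex.I * (t : ℂ) * ((lam i₂ - lam i₁ : ℝ) : ℂ)) *
          Complex.exp (Complex.I * t * lam i₁) := by
      rw [← Complex.exp_add]; push_cast; ring_nf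
    rw [hU, ← mul_one ‖_ - _ * _‖, ← hnorm (lam i₁), ← norm_mul, hexp]
    congr 1
    push_cast; ring
  have := norm_sub_le (U n w t a b) r
  linarith

/-! ### The explicit lower bound -/

lemma tau_pos {n : ℕ} (hn : 2 ≤ n) {w : ℝ} (hw : 1 < w) : 0 < tau n w := by
  have h1 : 1 < w ^ (2 * ⌈(n : ℝ) / 2⌉₊) := by
    refine one_lt_pow₀ hw ?_
    have : 0 < ⌈(n : ℝ) / 2⌉₊ := Nat.ceil_pos.2 (by positivity)
    omega
  unfold tau
  have : 0 < w - 1 := by linarith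
  have : 0 < w ^ (2 * ⌈(n : ℝ) / 2⌉₊) - 1 := by linarith
  positivity

lemma sigma_nonpos {n : ℕ} (hn : 2 ≤ n) {w : ℝ} (hw : 1 < w)
    (hτ : 2 ≤ w + 1 / w - tau n w) : sigma n w ≤ 0 := by
  have hτ0 := tau_pos hn hw
  have hn' : (0 : ℝ) < n - 1 := by
    have : (2 : ℝ) ≤ n := by exact_mod_cast hn
    linarith
  have hw0 : 0 < w := by linarith
  have hiw : 1 / w < 1 := by rw [div_lt_one hw0]; exact hw
  have hiw0 : 0 < 1 / w := by positivity
  have hK : 0 < w - 1 / w := by linarith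
  unfold sigma
  simp only
  split_ifs with h
  · apply div_nonpos_of_nonpos_of_nonneg
    · exact mul_nonpos_of_nonneg_of_nonpos hτ0.le (by linarith)
    · positivity
  · set τ := tau n w
    set g := w + 1 / w - τ with hg
    have hg2 : 2 < g := lt_of_le_of_ne hτ (Ne.symm h)
    set s := √(g ^ 2 - 4) with hs
    have hs0 : 0 < s := Real.sqrt_pos.2 (by nlinarith)
    have hsg : s ≤ g := Real.sqrt_le_iff.2 ⟨by linarith, by linarith⟩
    have hneg : -2 * (w + 1 / w) + τ ≤ 0 := by linarith
    apply mul_nonpos_of_nonneg_of_nonpos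
    · have : 0 < g := by linarith
      positivity
    · have e1 : w - 1 / w + (w + 1 / w) * (-2 * (w + 1 / w) + τ) / (w - 1 / w + s) ≤ 0 := by
        have hden : 0 < w - 1 / w + s := by linarith
        -- `s ≤ g` makes the denominator at most `2 * (w + 1 / w) - τ`.
        have : (w + 1 / w) * (-2 * (w + 1 / w) + τ) / (w - 1 / w + s) ≤ -(w + 1 / w) := by
          rw [div_le_iff₀ hden]
          nlinarith
        linarith
      have e2 : 16 * (-2 * (w + 1 / w) + τ) / (((n : ℝ) - 1) * (w - 1 / w) * s) ≤ 0 :=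
        div_nonpos_of_nonpos_of_nonneg (by linarith) (by positivity)
      linarith

/-- The correction in `lowerBound` is nonpositive, so only its limiting part has to be matched. -/
lemma lowerBound_le {n : ℕ} (hn : 2 ≤ n) {w : ℝ} (hw : 1 < w)
    (hτ : 2 ≤ w + 1 / w - tau n w) (α : ℝ) :
    lowerBound n w α ≤ (w ^ 2 - 1) / w ^ 2 * √((1 - Real.cos α) / 2) - 1 / w ^ 2 := by
  have hσ := sigma_nonpos hn hw hτ
  have hn' : (0 : ℝ) < n - 1 := by
    have : (2 : ℝ) ≤ n := by exact_mod_cast hn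
    linarith
  have hw2 : 0 < w ^ 2 - 1 := by nlinarith
  have hc : 0 ≤ 1 - Real.cos α ^ 2 := by
    nlinarith [Real.sin_sq_add_cos_sq α, sq_nonneg (Real.sin α)]
  have h1 : 0 ≤ (w ^ 2 - 1) * (1 - Real.cos α ^ 2) / √(8 * (1 - Real.cos α)) := by positivity
  have h2 : 0 ≤ 8 / (((n : ℝ) - 1) * w ^ 2) * (1 / (1 + 8 / (((n : ℝ) - 1) * (w ^ 2 - 1)))) := by
    positivity
  have := mul_nonpos_of_nonneg_of_nonpos h1
    (show -(8 / (((n : ℝ) - 1) * w ^ 2)) * (1 / (1 + 8 / (((n : ℝ) - 1) * (w ^ 2 - 1)))) +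
      sigma n w ≤ 0 by linarith)
  unfold lowerBound
  linarith

/-- For `a, b` of given sum the chord `|a - b e^{iθ}|` is shortest at `a = b`. -/
lemma add_mul_sqrt_le_norm (a b θ : ℝ) :
    (a + b) * √((1 - Real.cos θ) / 2) ≤ ‖(a : ℂ) - b * Complex.exp (Complex.I * θ)‖ := by
  have hsq : ‖(a : ℂ) - b * Complex.exp (Complex.I * θ)‖ ^ 2 =
      a ^ 2 + b ^ 2 - 2 * a * b * Real.cos θ := by
    rw [← Complex.normSq_eq_norm_sq, Complex.normSq_apply, mul_comm Complex.I, Complex.exp_mul_I,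
      ← Complex.ofReal_cos, ← Complex.ofReal_sin]
    simp [-Complex.ofReal_cos, -Complex.ofReal_sin]
    nlinarith [Real.sin_sq_add_cos_sq θ]
  have hc : 0 ≤ (1 - Real.cos θ) / 2 := by linarith [Real.cos_le_one θ]
  refine abs_le_of_sq_le_sq' ?_ (norm_nonneg _) |>.2
  rw [hsq, mul_pow, Real.sq_sqrt hc]
  nlinarith [mul_nonneg (by linarith [Real.neg_one_le_cos θ] : 0 ≤ 1 + Real.cos θ)
    (sq_nonneg (a - b))]

/-! ### Hyperbolic eigenvectors -/

/-- The vector `j ↦ x ^ (n - 1 - j) + ε x ^ j`, for `ε = ±1`. Up to a scalar it is the hyperbolic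
cosine (`ε = 1`) or sine (`ε = -1`) of `log x` times the signed distance from the midpoint. -/
def profile (n : ℕ) (x ε : ℝ) : Fin n → ℝ :=
  fun j => x ^ (n - 1 - (j : ℕ)) + ε * x ^ (j : ℕ)

/-- The profile is an eigenvector as soon as `x` meets the boundary condition at the loops,
which is the same at both ends. -/
lemma A_mulVec_profile {n : ℕ} (hn : 2 ≤ n) {w x ε : ℝ} (hx : x ≠ 0) (hε : ε ^ 2 = 1)
    (hroot : ε * x ^ n * (x - w) = w * x - 1) :
    A n w *ᵥ profile n x ε = (x + 1 / x) • profile n x ε := by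
  have hroot' : x ^ n * (x - w) = ε * (w * x - 1) := by
    linear_combination ε * hroot - x ^ n * (x - w) * hε
  ext i
  have h := A_mulVec hn w (fun j => x ^ (n - 1 - j) + ε * x ^ j) i
  change (A n w *ᵥ fun j : Fin n => x ^ (n - 1 - (j : ℕ)) + ε * x ^ (j : ℕ)) i = _
  rw [h, Pi.smul_apply, smul_eq_mul, profile]
  have hi := i.2
  obtain ⟨m, rfl⟩ : ∃ m, n = m + 2 := ⟨n - 2, by omega⟩
  generalize (i : ℕ) = k at hi
  by_cases h0 : k = 0
  · subst h0
    rw [if_pos (by omega), if_neg (by omega)]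
    simp only [show m + 2 - 1 - (0 + 1) = m by omega, show m + 2 - 1 - 0 = m + 1 by omega]
    field_simp
    linear_combination -hroot'
  · obtain ⟨k, rfl⟩ : ∃ l, k = l + 1 := ⟨k - 1, by omega⟩
    by_cases h1 : k + 1 + 1 < m + 2
    · obtain ⟨l, rfl⟩ : ∃ l, m = k + 1 + l := ⟨m - k - 1, by omega⟩
      rw [if_pos h1, if_pos (by omega)]
      simp only [show k + 1 + l + 2 - 1 - (k + 1 + 1) = l by omega,
        Nat.add_sub_cancel,
        show k + 1 + l + 2 - 1 - k = l + 2 by omega,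
        show k + 1 + l + 2 - 1 - (k + 1) = l + 1 by omega]
      field_simp
      ring
    · obtain rfl : k = m := by omega
      rw [if_neg h1, if_pos (by omega)]
      simp only [show k + 2 - 1 - (k + 1) = 0 by omega, Nat.add_sub_cancel,
        show k + 2 - 1 - k = 1 by omega]
      field_simp
      linear_combination -hroot

lemma profile_dotProduct_self {n : ℕ} (hn : 2 ≤ n) {x ε : ℝ} (hε : ε ^ 2 = 1) :
    (x ^ 2 - 1) * (profile n x ε ⬝ᵥ profile n x ε) =
      2 * (x ^ (2 * n) - 1) + 2 * n * ε * x ^ (n - 1) * (x ^ 2 - 1) := by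
  have hterm : ∀ j ∈ Finset.range n, (x ^ (n - 1 - j) + ε * x ^ j) * (x ^ (n - 1 - j) + ε * x ^ j) =
      (x ^ 2) ^ (n - 1 - j) + (x ^ 2) ^ j + 2 * ε * x ^ (n - 1) := by
    intro j hj
    rw [Finset.mem_range] at hj
    have : x ^ (n - 1) = x ^ (n - 1 - j) * x ^ j := by rw [← pow_add]; congr 1; omega
    rw [this, ← pow_mul, ← pow_mul, mul_comm 2, mul_comm 2, pow_mul, pow_mul]
    linear_combination (x ^ j) ^ 2 * hε
  simp only [dotProduct, profile]
  rw [Fin.sum_univ_eq_sum_range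
    (fun j => (x ^ (n - 1 - j) + ε * x ^ j) * (x ^ (n - 1 - j) + ε * x ^ j)) n,
    Finset.sum_congr rfl hterm, Finset.sum_add_distrib, Finset.sum_add_distrib,
    Finset.sum_range_reflect (fun j => (x ^ 2) ^ j) n, Finset.sum_const, Finset.card_range,
    nsmul_eq_mul]
  have := geom_sum_mul (x ^ 2) n
  rw [← pow_mul] at this
  linear_combination 2 * this

lemma profile_zero {n : ℕ} {x ε : ℝ} {i : Fin n} (hi : (i : ℕ) = 0) :
    profile n x ε i = x ^ (n - 1) + ε := by simp [profile, hi]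

lemma profile_last {n : ℕ} {x ε : ℝ} {i : Fin n} (hi : (i : ℕ) = n - 1) :
    profile n x ε i = 1 + ε * x ^ (n - 1) := by simp [profile, hi]

/-- The squared first entry of the normalised profile; the powers of `x` are eliminated with the
boundary condition. -/
lemma profile_zero_sq_div {n : ℕ} (hn : 2 ≤ n) {w x ε : ℝ} (hx : 1 < x)
    (hxw : x ≠ w) (hε : ε ^ 2 = 1) (hroot : ε * x ^ n * (x - w) = w * x - 1) :
    0 < (w ^ 2 - 1) * x + n * (w * x - 1) * (x - w) ∧
    (x ^ (n - 1) + ε) ^ 2 / (profile n x ε ⬝ᵥ profile n x ε) =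
      (x ^ 2 - 1) ^ 2 / (2 * x * ((w ^ 2 - 1) * x + n * (w * x - 1) * (x - w))) ∧
    profile n x ε ≠ 0 := by
  have hx0 : 0 < x := by linarith
  have hx2 : 0 < x ^ 2 - 1 := by nlinarith
  have hxw' : 0 < (x - w) ^ 2 := by
    have := sub_ne_zero.2 hxw
    positivity
  have hdot := profile_dotProduct_self hn (x := x) hε
  set N := profile n x ε ⬝ᵥ profile n x ε with hN
  obtain ⟨m, rfl⟩ : ∃ m, n = m + 1 := ⟨n - 1, by omega⟩
  rw [Nat.add_sub_cancel] at hdot ⊢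
  have hf0 : (x ^ m + ε) ^ 2 * (x ^ 2 * (x - w) ^ 2) = (x ^ 2 - 1) ^ 2 := by
    have : ε * (x ^ m + ε) * x * (x - w) = x ^ 2 - 1 := by
      linear_combination hroot + x * (x - w) * hε
    rw [← this]
    linear_combination (-(x ^ m + ε) ^ 2 * (x ^ 2 * (x - w) ^ 2)) * hε
  have hNx : N * (x * (x - w) ^ 2) =
      2 * ((w ^ 2 - 1) * x + ((m + 1 : ℕ) : ℝ) * (w * x - 1) * (x - w)) := by
    apply mul_left_cancel₀ hx2.ne'
    have h2 : x ^ (2 * (m + 1)) = (ε * x ^ (m + 1)) ^ 2 := by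
      rw [mul_pow, hε, one_mul, ← pow_mul, mul_comm]
    have h3 : x ^ (2 * (m + 1)) * (x - w) ^ 2 = (w * x - 1) ^ 2 := by
      rw [h2, ← mul_pow, hroot]
    have h4 : ε * x ^ m * x * (x - w) = w * x - 1 := by
      rw [← hroot]; ring
    linear_combination (x * (x - w) ^ 2) * hdot + 2 * x * h3 +
      2 * ((m + 1 : ℕ) : ℝ) * (x ^ 2 - 1) * (x - w) * h4
  have hne : profile (m + 1) x ε ≠ 0 := by
    intro h
    have h0 := congrFun h 0
    rw [profile_zero (by simp), Nat.add_sub_cancel, Pi.zero_apply] at h0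
    rw [h0] at hf0
    nlinarith [pow_pos hx2 2]
  have hNpos : 0 < N :=
    lt_of_le_of_ne (Finset.sum_nonneg fun j _ => mul_self_nonneg _)
      (Ne.symm (mt dotProduct_self_eq_zero.1 hne))
  have hD : 0 < (w ^ 2 - 1) * x + ((m + 1 : ℕ) : ℝ) * (w * x - 1) * (x - w) := by
    have : 0 < N * (x * (x - w) ^ 2) := by positivity
    linarith
  refine ⟨hD, ?_, hne⟩
  rw [div_eq_div_iff hNpos.ne' (by positivity), ← hf0]
  linear_combination -x * (x ^ m + ε) ^ 2 * hNx

/-! ### The bound on the sum of the two weights -/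

/-- The antisymmetric eigenvalue lies further below `w + 1/w` than the symmetric one lies above. -/
lemma gap_le_gap {n : ℕ} {w x y : ℝ} (hw : 1 < w) (hwn : (n : ℝ) + 1 ≤ (n - 1) * w)
    (hy : 1 < y) (hyw : y < w) (hwx : w < x)
    (hx : x ^ n * (x - w) = w * x - 1) (hy' : y ^ n * (w - y) = w * y - 1) :
    (w * x - 1) * (x - w) / x ≤ (w * y - 1) * (w - y) / y := by
  have hx0 : 0 < x := by linarith
  have hy0 : 0 < y := by linarith
  have hb : 0 < w * y - 1 := by nlinarith
  have ha : 0 < w * x - 1 := by nlinarith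
  have hn1 : (0 : ℝ) < n - 1 := by
    by_contra! h
    have : (0 : ℝ) ≤ n := by positivity
    nlinarith
  have e1 : (w * x - 1) * (x - w) / x = (w * x - 1) ^ 2 / x ^ (n + 1) := by
    rw [div_eq_div_iff (by positivity) (by positivity), pow_succ]
    linear_combination (w * x - 1) * x * hx
  have e2 : (w * y - 1) * (w - y) / y = (w * y - 1) ^ 2 / y ^ (n + 1) := by
    rw [div_eq_div_iff (by positivity) (by positivity), pow_succ]
    linear_combination (w * y - 1) * y * hy'
  rw [e1, e2, div_le_div_iff₀ (by positivity) (by positivity)]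
  -- Bernoulli's inequality for the ratio `x / y` and the exponent `(n + 1) / 2`.
  have hr : 1 ≤ x / y := by rw [one_le_div hy0]; linarith
  have hB := one_add_mul_self_le_rpow_one_add (s := x / y - 1) (by linarith)
    (p := ((n : ℝ) + 1) / 2) (by linarith)
  rw [add_sub_cancel] at hB
  have hlin : (w * x - 1) / (w * y - 1) ≤ 1 + ((n : ℝ) + 1) / 2 * (x / y - 1) := by
    have e3 : (w * x - 1) / (w * y - 1) = 1 + w * y / (w * y - 1) * (x / y - 1) := by
      field_simp
      ring
    have h4 : w * y / (w * y - 1) ≤ ((n : ℝ) + 1) / 2 := by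
      rw [div_le_div_iff₀ hb (by norm_num)]
      nlinarith
    rw [e3]
    have := mul_le_mul_of_nonneg_right h4 (sub_nonneg.2 hr)
    linarith
  have hsq : ((w * x - 1) / (w * y - 1)) ^ 2 ≤ (x / y) ^ (n + 1) := by
    calc ((w * x - 1) / (w * y - 1)) ^ 2 ≤ ((x / y) ^ (((n : ℝ) + 1) / 2)) ^ 2 :=
          pow_le_pow_left₀ (by positivity) (hlin.trans hB) 2
      _ = (x / y) ^ (n + 1) := by
          rw [← Real.rpow_natCast, ← Real.rpow_mul (by positivity), ← Real.rpow_natCast]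
          congr 1; push_cast; ring
  rw [div_pow, div_pow, div_le_div_iff₀ (by positivity) (by positivity)] at hsq
  linarith

/-- With `p` and `q` the scaled distances of the two eigenvalues from `w + 1/w`, the two weights
are `(w² - 1)/(2w²)` times `(1 + κp + p²)/(1 + np)` and `(1 - κq + q²)/(1 - nq)`. As `κ ≤ n`, these
are at least `1 - (n - κ)p` and `1 + (n - κ)q`, and `p ≤ q`. -/
lemma weights_add_ge {n : ℕ} {w x y : ℝ} (hw : 1 < w) (hnw : (n : ℝ) + 2 ≤ (n - 2) * w ^ 2)
    (hy : 1 < y) (hyw : y < w) (hwx : w < x)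
    (hDy : 0 < (w ^ 2 - 1) * y + n * (w * y - 1) * (y - w))
    (hgap : (w * x - 1) * (x - w) / x ≤ (w * y - 1) * (w - y) / y) :
    1 - 1 / w ^ 2 ≤ (x ^ 2 - 1) ^ 2 / (2 * x * ((w ^ 2 - 1) * x + n * (w * x - 1) * (x - w))) +
      (y ^ 2 - 1) ^ 2 / (2 * y * ((w ^ 2 - 1) * y + n * (w * y - 1) * (y - w))) := by
  have hx0 : 0 < x := by linarith
  have hy0 : 0 < y := by linarith
  have hw0 : 0 < w := by linarith
  have hK : 0 < w ^ 2 - 1 := by nlinarith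
  set K := w ^ 2 - 1 with hKdef
  set κ := 2 * (w ^ 2 + 1) / K with hκ
  have hκn : κ ≤ n := by
    rw [hκ, div_le_iff₀ hK, hKdef]; linarith
  set p := (w * x - 1) * (x - w) / x / K with hp
  set q := (w * y - 1) * (w - y) / y / K with hq
  have hp0 : 0 < p := by
    have h1 : 0 < w * x - 1 := by nlinarith
    have h2 : 0 < x - w := by linarith
    positivity
  have hpq : p ≤ q := by
    rw [hp, hq]; gcongr
  have ex : (x ^ 2 - 1) ^ 2 / (2 * x * (K * x + n * (w * x - 1) * (x - w))) =
      K / (2 * w ^ 2) * ((1 + κ * p + p ^ 2) / (1 + n * p)) := by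
    have h1 : K * x + n * (w * x - 1) * (x - w) = K * x * (1 + n * p) := by
      rw [hp]; field_simp
    have h2 : (x ^ 2 - 1) ^ 2 = K ^ 2 * x ^ 2 / w ^ 2 * (1 + κ * p + p ^ 2) := by
      rw [hp, hκ]; field_simp; rw [hKdef]; ring
    have h3 : 0 < 1 + n * p := by positivity
    rw [h1, h2]; field_simp
  have hq1 : 0 < 1 - n * q := by
    have h1 : K * y + n * (w * y - 1) * (y - w) = K * y * (1 - n * q) := by
      rw [hq]; field_simp; ring
    rw [h1] at hDy
    exact pos_of_mul_pos_right hDy (by positivity)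
  have ey : (y ^ 2 - 1) ^ 2 / (2 * y * (K * y + n * (w * y - 1) * (y - w))) =
      K / (2 * w ^ 2) * ((1 - κ * q + q ^ 2) / (1 - n * q)) := by
    have h1 : K * y + n * (w * y - 1) * (y - w) = K * y * (1 - n * q) := by
      rw [hq]; field_simp; ring
    have h2 : (y ^ 2 - 1) ^ 2 = K ^ 2 * y ^ 2 / w ^ 2 * (1 - κ * q + q ^ 2) := by
      rw [hq, hκ]; field_simp; rw [hKdef]; ring
    rw [h1, h2]; field_simp
  rw [ex, ey, ← mul_add]
  have hp1 : 0 < 1 + n * p := by positivity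
  have hsum : 2 ≤ (1 + κ * p + p ^ 2) / (1 + n * p) + (1 - κ * q + q ^ 2) / (1 - n * q) := by
    have h1 : 1 - (n - κ) * p ≤ (1 + κ * p + p ^ 2) / (1 + n * p) := by
      rw [le_div_iff₀ hp1]
      nlinarith [mul_nonneg (mul_nonneg (sub_nonneg.2 hκn) (Nat.cast_nonneg (α := ℝ) n))
        (sq_nonneg p)]
    have h2 : 1 + (n - κ) * q ≤ (1 - κ * q + q ^ 2) / (1 - n * q) := by
      rw [le_div_iff₀ hq1]
      nlinarith [mul_nonneg (mul_nonneg (sub_nonneg.2 hκn) (Nat.cast_nonneg (α := ℝ) n))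
        (sq_nonneg q)]
    nlinarith [mul_nonneg (sub_nonneg.2 hκn) (sub_nonneg.2 hpq)]
  calc 1 - 1 / w ^ 2 = K / (2 * w ^ 2) * 2 := by rw [hKdef]; field_simp
    _ ≤ _ := mul_le_mul_of_nonneg_left hsum (by positivity)

/-! ### Existence of the two eigenvalues above `2` -/

lemma exists_symm_root {n : ℕ} (hn : 2 ≤ n) {w : ℝ} (hw : 1 < w) :
    ∃ x, w < x ∧ x ^ n * (x - w) = w * x - 1 := by
  have hc : ContinuousOn (fun x : ℝ => x ^ n * (x - w) - (w * x - 1)) (Set.Icc w (w + 1)) := by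
    fun_prop
  have hr : (w + 1) ^ 2 ≤ (w + 1) ^ n := pow_le_pow_right₀ (by linarith) hn
  obtain ⟨x, hx, h⟩ := intermediate_value_Icc (by linarith : w ≤ w + 1) hc
    (show (0 : ℝ) ∈ _ from ⟨by nlinarith, by nlinarith⟩)
  simp only at h
  refine ⟨x, lt_of_le_of_ne hx.1 ?_, by linarith⟩
  rintro rfl
  nlinarith

lemma exists_antisymm_root {n : ℕ} {w : ℝ} (hw : 1 < w) (hwn : (n : ℝ) + 1 < (n - 1) * w) :
    ∃ y, 1 < y ∧ y < w ∧ y ^ n * (w - y) = w * y - 1 := by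
  have hn0 : (0 : ℝ) < n := by
    by_contra! h
    nlinarith
  -- Just to the right of `1` the difference of the two sides is positive, by Bernoulli.
  set δ : ℝ := ((n - 1) * w - (n + 1)) / (2 * n) with hδ
  have hδn : 2 * (n * δ) = (n - 1) * w - (n + 1) := by rw [hδ]; field_simp
  have hδ0 : 0 < δ := div_pos (by linarith) (by positivity)
  have hδw : 1 + δ < w := by
    by_contra! h
    nlinarith
  have hB : 1 + n * δ ≤ (1 + δ) ^ n := one_add_mul_le_pow (by linarith) n
  have hstart : 0 ≤ (1 + δ) ^ n * (w - (1 + δ)) - (w * (1 + δ) - 1) := by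
    nlinarith [mul_le_mul_of_nonneg_right hB (sub_nonneg.2 hδw.le), mul_pos hδ0 hn0]
  have hc : ContinuousOn (fun y : ℝ => y ^ n * (w - y) - (w * y - 1)) (Set.Icc (1 + δ) w) := by
    fun_prop
  obtain ⟨y, hy, h⟩ := intermediate_value_Icc' hδw.le hc
    (show (0 : ℝ) ∈ _ from ⟨by nlinarith, hstart⟩)
  simp only at h
  refine ⟨y, by linarith [hy.1], lt_of_le_of_ne hy.2 ?_, by linarith⟩
  rintro rfl
  nlinarith

/-! ### Consequences of the hypothesis on `tau` -/

/-- The left-hand side is in fact bounded; the linear bound is all that is needed, and it passes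
from `m` to `m + 1` by Bernoulli's inequality. -/
lemma one_add_div_pow_le {m : ℕ} (hm : 4 ≤ m) :
    (1 + 4 / (2 * (m : ℝ) - 3)) ^ m ≤ 4 * m - 5 := by
  induction m, hm using Nat.le_induction with
  | base => norm_num
  | succ m hm ih =>
    have hm' : (4 : ℝ) ≤ m := by exact_mod_cast hm
    have h1 : 0 < 2 * (m : ℝ) - 3 := by linarith
    have h2 : 0 < 2 * (m : ℝ) - 1 := by linarith
    have h3 : 0 < 2 * (m : ℝ) + 3 := by linarith
    have h5 : 0 < 4 * (m : ℝ) - 5 := by linarith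
    set a := 1 + 4 / (2 * (m : ℝ) - 3) with ha
    set b := 1 + 4 / (2 * (m : ℝ) - 1) with hb
    set c := 8 / ((2 * (m : ℝ) - 3) * (2 * m + 3)) with hc
    have hab : a = b * (1 + c) := by
      rw [ha, hb, hc]; field_simp; ring
    have hc0 : 0 < c := by positivity
    have hb0 : 0 < b := by positivity
    have hB : 1 + m * c ≤ (1 + c) ^ m := one_add_mul_le_pow (by linarith) m
    have hrat : b * (4 * m - 5) ≤ (4 * m - 1) * (1 + m * c) := by
      have hb' : b = (2 * m + 3) / (2 * m - 1) := by rw [hb]; field_simp; ring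
      have hc' : 1 + m * c = (4 * m ^ 2 + 8 * m - 9) / ((2 * m - 3) * (2 * m + 3)) := by
        rw [hc, mul_div_assoc', one_add_div (by positivity)]; ring
      rw [hb', hc', div_mul_eq_mul_div, mul_div_assoc', div_le_div_iff₀ h2 (by positivity)]
      nlinarith [mul_nonneg (sub_nonneg.2 hm') (sub_nonneg.2 hm'),
        mul_nonneg (mul_nonneg (sub_nonneg.2 hm') (sub_nonneg.2 hm')) (sub_nonneg.2 hm')]
    have hcast : 2 * ((m + 1 : ℕ) : ℝ) - 3 = 2 * m - 1 := by push_cast; ring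
    rw [hcast, ← hb]
    have hmc : 0 < 1 + m * c := by positivity
    have hfin : b ^ (m + 1) * (1 + m * c) ≤ (4 * m - 1) * (1 + m * c) := by
      calc b ^ (m + 1) * (1 + m * c) ≤ b ^ (m + 1) * (1 + c) ^ m := by gcongr
        _ = b * a ^ m := by rw [hab, mul_pow]; ring
        _ ≤ b * (4 * m - 5) := by gcongr
        _ ≤ _ := hrat
    have := le_of_mul_le_mul_right hfin hmc
    push_cast; linarith

/-- The spectral-gap hypothesis in polynomial form. -/
lemma le_of_two_le_sub_tau {n m : ℕ} (hm : m = ⌈(n : ℝ) / 2⌉₊) (hm0 : 0 < m) {w : ℝ} (hw : 1 < w)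
    (hτ : 2 ≤ w + 1 / w - tau n w) : (w + 1) ^ 2 ≤ (w - 1) * (w ^ (2 * m) - 1) := by
  have hw0 : 0 < w := by linarith
  have h1 : 0 < w ^ (2 * m) - 1 := sub_pos.2 (one_lt_pow₀ hw (by omega))
  rw [tau, ← hm] at hτ
  have h2 : (w + 1) ^ 2 * (w - 1) / (w * (w ^ (2 * m) - 1)) ≤ (w - 1) ^ 2 / w := by
    have : w + 1 / w - 2 = (w - 1) ^ 2 / w := by field_simp; ring
    linarith
  rw [div_le_div_iff₀ (by positivity) hw0] at h2
  have h3 : 0 < (w - 1) * w := mul_pos (by linarith) hw0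
  refine le_of_mul_le_mul_right ?_ h3
  nlinarith

/-- For `n ≥ 4` the spectral-gap hypothesis gives `κ = 2(w² + 1)/(w² - 1) ≤ n`. If instead
`w² < (n + 2)/(n - 2)`, then `w ^ (2m)` with `m = ⌈n/2⌉` is too small for the hypothesis to hold. -/
lemma le_mul_sq_of_two_le_sub_tau {n : ℕ} (hn : 4 ≤ n) {w : ℝ} (hw : 1 < w)
    (hτ : 2 ≤ w + 1 / w - tau n w) : (n : ℝ) + 2 ≤ (n - 2) * w ^ 2 := by
  have hn' : (4 : ℝ) ≤ n := by exact_mod_cast hn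
  obtain ⟨m, hm⟩ : ∃ m, m = ⌈(n : ℝ) / 2⌉₊ := ⟨_, rfl⟩
  have hm2 : (n : ℝ) ≤ 2 * m := by
    have := Nat.le_ceil ((n : ℝ) / 2)
    rw [← hm] at this; linarith
  have hm1 : (2 : ℝ) * m < n + 2 := by
    have := Nat.ceil_lt_add_one (show 0 ≤ (n : ℝ) / 2 by positivity)
    rw [← hm] at this; linarith
  have hm2' : n ≤ 2 * m := by exact_mod_cast hm2
  have hm1' : 2 * m < n + 2 := by exact_mod_cast hm1
  have hmn : (2 : ℝ) * m - 1 ≤ n := by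
    have : 2 * m ≤ n + 1 := by omega
    have : (2 : ℝ) * m ≤ n + 1 := by exact_mod_cast this
    linarith
  have hH := le_of_two_le_sub_tau hm (by omega) hw hτ
  by_contra! hlt
  rw [pow_mul] at hH
  rcases (by omega : m = 2 ∨ m = 3 ∨ 4 ≤ m) with rfl | rfl | hm4
  · obtain rfl : n = 4 := by omega
    norm_num at hlt
    have hu : w ^ 2 < 3 := by linarith
    have h1 : w < 1.7321 := by nlinarith
    have h2 : (w + 1) ≤ (w - 1) ^ 2 * (w ^ 2 + 1) := by
      refine le_of_mul_le_mul_right ?_ (by linarith : 0 < w + 1)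
      linarith
    nlinarith [mul_pos (sub_pos.2 hw) (sub_pos.2 hw)]
  · have hu : w ^ 2 < 7 / 3 := by
      have : (5 : ℝ) ≤ n := by norm_num at hmn; exact_mod_cast hmn
      nlinarith
    have h1 : w < 1.5276 := by nlinarith
    have h2 : (w + 1) ≤ (w - 1) ^ 2 * ((w ^ 2) ^ 2 + w ^ 2 + 1) := by
      refine le_of_mul_le_mul_right ?_ (by linarith : 0 < w + 1)
      linarith
    have h3 : (w ^ 2) ^ 2 + w ^ 2 + 1 ≤ 79 / 9 := by nlinarith
    have h4 : (w - 1) ^ 2 * ((w ^ 2) ^ 2 + w ^ 2 + 1) ≤ (w - 1) ^ 2 * (79 / 9) := by gcongr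
    nlinarith
  · have hm4' : (4 : ℝ) ≤ m := by exact_mod_cast hm4
    have h0 : 0 < 2 * (m : ℝ) - 3 := by linarith
    have hu : w ^ 2 ≤ 1 + 4 / (2 * (m : ℝ) - 3) := by
      have : w ^ 2 - 1 ≤ 4 / (2 * (m : ℝ) - 3) := by
        rw [le_div_iff₀ h0]
        nlinarith
      linarith
    have h1 : (w ^ 2) ^ m ≤ 4 * m - 5 :=
      (pow_le_pow_left₀ (by positivity) hu m).trans (one_add_div_pow_le hm4)
    have h2 : (w ^ 2 - 1) * (2 * m - 3) ≤ 4 := by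
      rw [← le_div_iff₀ h0]; linarith
    have h3 : (w - 1) * ((w ^ 2) ^ m - 1) ≤ (w - 1) * (4 * m - 6) :=
      mul_le_mul_of_nonneg_left (by linarith) (by linarith)
    have h4 : (w + 1) ^ 3 ≤ 8 := by
      calc (w + 1) ^ 3 = (w + 1) * (w + 1) ^ 2 := by ring
        _ ≤ (w + 1) * ((w - 1) * (4 * m - 6)) :=
          mul_le_mul_of_nonneg_left (hH.trans h3) (by linarith)
        _ = 2 * ((w ^ 2 - 1) * (2 * m - 3)) := by ring
        _ ≤ 8 := by linarith
    nlinarith [pow_lt_pow_left₀ (by linarith : (2 : ℝ) < w + 1) (by norm_num) (by norm_num : 3 ≠ 0)]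

/-! ### Weights of the end vertices in the first two eigenvectors -/

section

variable {n : ℕ} {w : ℝ} {V : Matrix (Fin n) (Fin n) ℝ} {lam : Fin n → ℝ} {i₁ i₂ l : Fin n}

/-- What the fidelity bound needs of the first two columns of `V`: they take equal, respectively
opposite, values at the two ends `i₁` and `l`, and together carry weight at least `1 - 1/w²` at
an end. -/
structure GoodColumns (w : ℝ) (V : Matrix (Fin n) (Fin n) ℝ) (i₁ i₂ l : Fin n) : Prop where
  symm : V i₁ i₁ * V l i₁ = V i₁ i₁ ^ 2
  symm_sq : V l i₁ ^ 2 = V i₁ i₁ ^ 2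
  antisymm : V i₁ i₂ * V l i₂ = -V i₁ i₂ ^ 2
  antisymm_sq : V l i₂ ^ 2 = V i₁ i₂ ^ 2
  weight : 1 - 1 / w ^ 2 ≤ V i₁ i₁ ^ 2 + V i₁ i₂ ^ 2

lemma goodColumns_of_eigenvectors
    (hV : V ∈ Matrix.orthogonalGroup (Fin n) ℝ)
    (hd : Vᵀ * A n w * V = Matrix.diagonal lam) (hlam : Antitone lam)
    (hi₁ : (i₁ : ℕ) = 0) (hi₂ : (i₂ : ℕ) = 1)
    {u₁ u₂ : Fin n → ℝ} {μ₁ μ₂ : ℝ} (hu₁ : A n w *ᵥ u₁ = μ₁ • u₁) (hu₂ : A n w *ᵥ u₂ = μ₂ • u₂)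
    (hu₁0 : u₁ ≠ 0) (hu₂0 : u₂ ≠ 0) (hμ : μ₂ < μ₁)
    (hrest : ∀ k : Fin n, 2 ≤ (k : ℕ) → lam k < μ₂)
    (h₁ : u₁ l = u₁ i₁) (h₂ : u₂ l = -u₂ i₁)
    (hweight : 1 - 1 / w ^ 2 ≤ u₁ i₁ ^ 2 / (u₁ ⬝ᵥ u₁) + u₂ i₁ ^ 2 / (u₂ ⬝ᵥ u₂)) :
    GoodColumns w V i₁ i₂ l := by
  have key := columns_of_eigenvectors hV hd hlam hi₁ hi₂ hu₁ hu₂ hu₁0 hu₂0 hμ hrest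
  refine ⟨?_, ?_, ?_, ?_, ?_⟩
  · rw [sq, (key i₁ l).1, (key i₁ i₁).1, h₁]
  · rw [sq, sq, (key l l).1, (key i₁ i₁).1, h₁]
  · rw [sq, (key i₁ l).2, (key i₁ i₁).2, h₂]; ring
  · rw [sq, sq, (key l l).2, (key i₁ i₁).2, h₂]; ring
  · rw [sq (V i₁ i₁), sq (V i₁ i₂), (key i₁ i₁).1, (key i₁ i₁).2, ← sq, ← sq]; exact hweight

lemma goodColumns_two {V : Matrix (Fin 2) (Fin 2) ℝ} {lam : Fin 2 → ℝ} {i₁ i₂ l : Fin 2}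
    (hV : V ∈ Matrix.orthogonalGroup (Fin 2) ℝ)
    (hd : Vᵀ * A 2 w * V = Matrix.diagonal lam) (hlam : Antitone lam)
    (hi₁ : (i₁ : ℕ) = 0) (hi₂ : (i₂ : ℕ) = 1) (hl : (l : ℕ) = 1) :
    GoodColumns w V i₁ i₂ l := by
  obtain rfl : i₁ = 0 := Fin.ext hi₁
  obtain rfl : i₂ = 1 := Fin.ext hi₂
  obtain rfl : l = 1 := Fin.ext hl
  refine goodColumns_of_eigenvectors (μ₁ := w + 1) (μ₂ := w - 1) (u₁ := ![1, 1]) (u₂ := ![1, -1])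
    hV hd hlam rfl rfl ?_ ?_ ?_ ?_ (by linarith) ?_ ?_ ?_ ?_
  · ext i
    fin_cases i
    · simp [A, Matrix.mulVec, dotProduct]
    · simp [A, Matrix.mulVec, dotProduct]; ring
  · ext i; fin_cases i <;> simp [A, Matrix.mulVec, dotProduct] <;> ring
  · intro h; simpa using congrFun h 0
  · intro h; simpa using congrFun h 0
  · intro k hk; omega
  · simp
  · simp
  · norm_num [dotProduct, Fin.sum_univ_two]
    positivity

lemma goodColumns_three {V : Matrix (Fin 3) (Fin 3) ℝ} {lam : Fin 3 → ℝ} {i₁ i₂ l : Fin 3}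
    (hw : 1 < w) (hV : V ∈ Matrix.orthogonalGroup (Fin 3) ℝ)
    (hd : Vᵀ * A 3 w * V = Matrix.diagonal lam) (hlam : Antitone lam)
    (hi₁ : (i₁ : ℕ) = 0) (hi₂ : (i₂ : ℕ) = 1) (hl : (l : ℕ) = 2) :
    GoodColumns w V i₁ i₂ l := by
  obtain rfl : i₁ = 0 := Fin.ext hi₁
  obtain rfl : i₂ = 1 := Fin.ext hi₂
  obtain rfl : l = 2 := Fin.ext hl
  -- The symmetric eigenvector `(1, x, 1)` has eigenvalue `w + x`, where `x (w + x) = 2`.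
  obtain ⟨x, hx0, hx⟩ : ∃ x : ℝ, 0 < x ∧ x * (w + x) = 2 := by
    have h8 : w < √(w ^ 2 + 8) := Real.lt_sqrt_of_sq_lt (by linarith)
    have hs : √(w ^ 2 + 8) ^ 2 = w ^ 2 + 8 := Real.sq_sqrt (by positivity)
    exact ⟨(√(w ^ 2 + 8) - w) / 2, by linarith, by nlinarith⟩
  have htr : lam 0 + lam 1 + lam 2 = 2 * w := by
    have h1 : V * Vᵀ = 1 := (Matrix.mem_orthogonalGroup_iff (Fin 3) ℝ).1 hV
    have h2 := congrArg Matrix.trace hd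
    rw [Matrix.trace_mul_comm, ← Matrix.mul_assoc, h1, Matrix.one_mul, Matrix.trace_diagonal,
      Fin.sum_univ_three, Matrix.trace_fin_three] at h2
    rw [← h2]
    simp [A]; ring
  refine goodColumns_of_eigenvectors (μ₁ := w + x) (μ₂ := w) (u₁ := ![1, x, 1])
    (u₂ := ![1, 0, -1]) hV hd hlam rfl rfl ?_ ?_ ?_ ?_ (by linarith) ?_ ?_ ?_ ?_
  · ext i; fin_cases i <;> simp [A, Matrix.mulVec, dotProduct, Fin.sum_univ_three] <;> linarith
  · ext i; fin_cases i <;> simp [A, Matrix.mulVec, dotProduct, Fin.sum_univ_three]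
  · intro h; simpa using congrFun h 0
  · intro h; simpa using congrFun h 0
  · intro k hk
    obtain rfl : k = 2 := Fin.ext (by omega)
    have h1 : lam 2 ≤ lam 1 := hlam (by decide)
    have h2 : lam 1 ≤ lam 0 := hlam (by decide)
    linarith
  · simp
  · simp
  · have e1 : ![1, x, 1] ⬝ᵥ ![1, x, 1] = 2 + x ^ 2 := by
      simp [dotProduct, Fin.sum_univ_three]; ring
    have e2 : (![1, 0, -1] : Fin 3 → ℝ) ⬝ᵥ ![1, 0, -1] = 2 := by
      simp [dotProduct, Fin.sum_univ_three]
      norm_num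
    rw [e1, e2]
    have h3 : 1 / 2 - 1 / w ^ 2 ≤ 1 / (2 + x ^ 2) := by
      have hw0 : 0 < w := by linarith
      rw [div_sub_div _ _ (by norm_num) (by positivity),
        div_le_div_iff₀ (by positivity) (by positivity)]
      have h4 : x * w ≤ 2 := by nlinarith
      have h5 : (x * w) ^ 2 ≤ 2 ^ 2 := pow_le_pow_left₀ (by positivity) h4 2
      nlinarith [sq_nonneg x]
    simp only [Matrix.cons_val_zero]
    linarith

/-- For `n ≥ 4` the hypothesis on `tau` forces both eigenvalues `x + 1/x` and `y + 1/y` of the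
hyperbolic profiles to exceed `2`, so they are the two largest ones. -/
lemma goodColumns_of_four_le (hn : 4 ≤ n) (hw : 1 < w) (hτ : 2 ≤ w + 1 / w - tau n w)
    (hV : V ∈ Matrix.orthogonalGroup (Fin n) ℝ)
    (hd : Vᵀ * A n w * V = Matrix.diagonal lam) (hlam : Antitone lam)
    (hi₁ : (i₁ : ℕ) = 0) (hi₂ : (i₂ : ℕ) = 1) (hl : (l : ℕ) = n - 1) :
    GoodColumns w V i₁ i₂ l := by
  have hn2 : 2 ≤ n := by omega
  have hn' : (4 : ℝ) ≤ n := by exact_mod_cast hn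
  have hnw := le_mul_sq_of_two_le_sub_tau hn hw hτ
  have hwn : (n : ℝ) + 1 < (n - 1) * w := by
    refine lt_of_pow_lt_pow_left₀ 2 (by nlinarith) ?_
    -- `((n + 1) / (n - 1))² < (n + 2) / (n - 2)`
    refine lt_of_mul_lt_mul_left ?_ (by linarith : (0 : ℝ) ≤ n - 2)
    calc ((n : ℝ) - 2) * (n + 1) ^ 2 < (n - 1) ^ 2 * (n + 2) := by nlinarith
      _ ≤ (n - 1) ^ 2 * ((n - 2) * w ^ 2) := by gcongr
      _ = (n - 2) * ((n - 1) * w) ^ 2 := by ring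
  obtain ⟨x, hwx, hx⟩ := exists_symm_root hn2 hw
  obtain ⟨y, hy, hyw, hy'⟩ := exists_antisymm_root hw hwn
  have hx1 : 1 < x := hw.trans hwx
  have hrx : 1 * x ^ n * (x - w) = w * x - 1 := by linarith
  have hry : -1 * y ^ n * (y - w) = w * y - 1 := by linarith
  obtain ⟨-, hNx, hux⟩ := profile_zero_sq_div hn2 hx1 hwx.ne' (by norm_num) hrx
  obtain ⟨hDy, hNy, huy⟩ := profile_zero_sq_div hn2 hy hyw.ne (by norm_num) hry
  have hmono : y + 1 / y < x + 1 / x := by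
    have hx0 : 0 < x := by linarith
    have hy0 : 0 < y := by linarith
    have : x + 1 / x - (y + 1 / y) = (x - y) * (x * y - 1) / (x * y) := by field_simp; ring
    have h2 : 0 < (x - y) * (x * y - 1) / (x * y) :=
      div_pos (mul_pos (by linarith) (by nlinarith)) (by positivity)
    linarith
  have hy2 : 2 < y + 1 / y := by
    have hy0 : 0 < y := by linarith
    have : y + 1 / y - 2 = (y - 1) ^ 2 / y := by field_simp; ring
    have h2 : 0 < (y - 1) ^ 2 / y := div_pos (pow_pos (by linarith) 2) hy0
    linarith
  refine goodColumns_of_eigenvectors hV hd hlam hi₁ hi₂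
    (A_mulVec_profile hn2 (by linarith) (by norm_num) hrx)
    (A_mulVec_profile hn2 (by linarith) (by norm_num) hry) hux huy hmono
    (fun k hk => (lam_le_two hn2 (by linarith) hV hd hlam hk).trans_lt hy2) ?_ ?_ ?_
  · rw [profile_last hl, profile_zero hi₁]; ring
  · rw [profile_last hl, profile_zero hi₁]; ring
  · rw [profile_zero hi₁, profile_zero hi₁, hNx, hNy]
    exact weights_add_ge hw hnw hy hyw hwx hDy (gap_le_gap hw hwn.le hy hyw hwx hx hy')

lemma goodColumns (hn : 2 ≤ n) (hw : 1 < w) (hτ : 2 ≤ w + 1 / w - tau n w)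
    (hV : V ∈ Matrix.orthogonalGroup (Fin n) ℝ)
    (hd : Vᵀ * A n w * V = Matrix.diagonal lam) (hlam : Antitone lam)
    (hi₁ : (i₁ : ℕ) = 0) (hi₂ : (i₂ : ℕ) = 1) (hl : (l : ℕ) = n - 1) :
    GoodColumns w V i₁ i₂ l := by
  rcases (by omega : n = 2 ∨ n = 3 ∨ 4 ≤ n) with rfl | rfl | h
  · exact goodColumns_two hV hd hlam hi₁ hi₂ hl
  · exact goodColumns_three hw hV hd hlam hi₁ hi₂ hl
  · exact goodColumns_of_four_le h hw hτ hV hd hlam hi₁ hi₂ hl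

end

end PathFidelity

theorem mainTheorem2 (n : ℕ) (hn : 2 ≤ n) (w : ℝ) (hw : 1 < w)
    (hτ : 2 ≤ w + 1 / w - PathFidelity.tau n w)
    (V : Matrix (Fin n) (Fin n) ℝ) (lam : Fin n → ℝ)
    (hV : V ∈ Matrix.orthogonalGroup (Fin n) ℝ)
    (hdiag : Vᵀ * PathFidelity.A n w * V = Matrix.diagonal lam)
    (hlam : Antitone lam)
    (i₁ i₂ iₙ : Fin n) (hi₁ : (i₁ : ℕ) = 0) (hi₂ : (i₂ : ℕ) = 1) (hiₙ : (iₙ : ℕ) = n - 1)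
    (t α : ℝ) (hα : α = t * (lam i₁ - lam i₂))
    (hα_ne : ∀ k : ℤ, α ≠ 2 * (k : ℝ) * Real.pi) :
    PathFidelity.lowerBound n w α ≤
        ‖((V i₁ i₁ ^ 2 : ℝ) : ℂ) - ((V i₁ i₂ ^ 2 : ℝ) : ℂ) *
            Complex.exp (Complex.I * (t : ℂ) * ((lam i₂ - lam i₁ : ℝ) : ℂ))‖
          + V i₁ i₁ ^ 2 + V i₁ i₂ ^ 2 - 1 ∧
      (0 ≤ PathFidelity.lowerBound n w α →
        PathFidelity.lowerBound n w α ^ 2 ≤ PathFidelity.fidelity n w i₁ iₙ t) := by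
  obtain ⟨h1, h1', h2, h2', hS⟩ := PathFidelity.goodColumns hn hw hτ hV hdiag hlam hi₁ hi₂ hiₙ
  have h12 : i₁ ≠ i₂ := by
    rintro rfl
    omega
  have hU := PathFidelity.sub_le_norm_U hV hdiag t h12 h1 h1' h2 h2'
  have hL := PathFidelity.lowerBound_le hn hw hτ α
  have hchord := PathFidelity.add_mul_sqrt_le_norm (V i₁ i₁ ^ 2) (V i₁ i₂ ^ 2) (-α)
  rw [Real.cos_neg] at hchord
  have harg : Complex.I * (t : ℂ) * ((lam i₂ - lam i₁ : ℝ) : ℂ) = Complex.I * ((-α : ℝ) : ℂ) := by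
    rw [hα]; push_cast; ring
  rw [harg] at hU ⊢
  have hw2 : (w ^ 2 - 1) / w ^ 2 = 1 - 1 / w ^ 2 := by
    have : w ≠ 0 := by linarith
    field_simp
  have hmul := mul_le_mul_of_nonneg_right hS (Real.sqrt_nonneg ((1 - Real.cos α) / 2))
  rw [hw2] at hL
  have hfirst : PathFidelity.lowerBound n w α ≤
      ‖((V i₁ i₁ ^ 2 : ℝ) : ℂ) - ((V i₁ i₂ ^ 2 : ℝ) : ℂ) *
        Complex.exp (Complex.I * ((-α : ℝ) : ℂ))‖ + V i₁ i₁ ^ 2 + V i₁ i₂ ^ 2 - 1 := by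
    linarith
  exact ⟨hfirst, fun h0 => pow_le_pow_left₀ h0 (hfirst.trans hU) 2⟩
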